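/- Graphs are finite and may have loops and parallel edges: a graph consists of a finite set of vertices, a finite set of half-edges, a map attaching each half-edge to a vertex, and a fixed-point-free involution pairing the half-edges into edges. The degree of a vertex is the number of half-edges attached to it (so a loop counts twice). $\operatorname{Aut} G$ is the group of pairs (permutation of the vertices, permutation of the half-edges) compatible with this structure; thus it also contains the permutations of parallel edges and the flips of loops. A coloring of $G$ is a map $c\colon V(G)\to\{\text{white},\text{black}\}$, and the black-white polynomial is $$W_G(t)=\sum_{c} t^{a(c)}\in\mathbb Z[t],$$ where $a(c)$ is the number of white vertices $v$ for which the number of edges joining $v$ to black vertices, counted with multiplicity, is even. For the empty graph $W_\emptyset=1$. For a finitely supported vector $\mathbf n=(n_1,n_2,\dots)$ of nonnegative integers let $|\mathbf n|=\sum_k k\,n_k$, let $G(\mathbf n)$ be the set of isomorphism classes of graphs with exactly $n_k$ vertices of degree $k$ for all $k\ge1$ and no vertex of degree $0$, and let $G_c(\mathbf n)\subset G(\mathbf n)$ be the subset of connected graphs (the empty graph is not connected). Let $$\mathscr B(u)=\sum_{\mathbf n}u^{|\mathbf n|}\sum_{G\in G_c(\mathbf n)}\frac{W_G(t)\prod_k\xi_k^{n_k}}{|\operatorname{Aut}G|}\in\mathbb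 Q[t,\xi_1,\xi_2,\dots][[u]].$$ Let $\langle\ \rangle_{bw}$ be the linear functional on polynomials in $b,w,y,z$ with $$\langle b^nw^my^kz^l\rangle_{bw}=W_2(n)\,W_2(m)\,\delta_{kl}\,k!,$$ where $W_2(n)=n!/(2^{n/2}(n/2)!)$ for even $n$ and $W_2(n)=0$ for odd $n$; extend it linearly over $\mathbb Q[t,\xi_1,\xi_2,\dots]$ and coefficientwise to power series in $u$. Let $p(i)=t$ if $i\ge0$ is even and $p(i)=1$ if $i$ is odd, and put $$\mathbf F(n)=(b+y)^n+\sum_{i=0}^n\binom ni p(i)\,w^{n-i}z^i,\qquad S(u)=\sum_{k\ge1}\mathbf F(k)\frac{\xi_ku^k}{k!}.$$ **Theorem.** For every $d\geq 0$ there are only finitely many $\mathbf n$ with $|\mathbf n|=d$, every set $G(\mathbf n)$ is finite, and $$\langle\exp S(u)\rangle_{bw}=\sum_{\mathbf n}u^{|\mathbf n|}\sum_{G\in G(\mathbf n)}\frac{W_G(t)\prod_k\xi_k^{n_k}}{|\operatorname{Aut}G|}.$$ This series has constant term $1$, and $$\mathscr B(u)=\log\,\langle\exp S(u)\rangle_{bw}.$$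 -/

import Mathlib

noncomputable section

namespace BW

/-! ### Multigraphs, with loops and parallel edges, through half-edges -/

/-- A multigraph with vertex set `V` and set of half-edges `H`. Every half-edge `h` is attached to
the vertex `vert h`, and the fixed-point free involution `flip` pairs the half-edges. The edges are
the pairs `{h, flip h}`; such an edge is a loop if `vert (flip h) = vert h`. -/
@[ext] structure Multigraph (V H : Type*) where
  vert : H → V
  flip : H → H
  flip_flip : ∀ h, flip (flip h) = h
  flip_ne : ∀ h, flip h ≠ h

namespace Multigraph

variable {V H V' H' V'' H'' : Type*}

/-- The degree of a vertex: the number of half-edges at it (so that a loop counts twice). -/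
def degree [DecidableEq V] [Fintype H] (G : Multigraph V H) (v : V) : ℕ :=
  (Finset.univ.filter fun h => G.vert h = v).card

/-- The number of half-edges at `v` that belong to an edge whose other end is black
(`1 : ZMod 2` is black, `0 : ZMod 2` is white). For a white vertex `v` this is the sum of the
multiplicities of the edges from `v` to its black neighbours, and loops at `v` do not matter. -/
def blackDegree [DecidableEq V] [Fintype H] (G : Multigraph V H) (c : V → ZMod 2) (v : V) : ℕ :=
  (Finset.univ.filter fun h => G.vert h = v ∧ c (G.vert (G.flip h)) = 1).card

/-- The black-white polynomial `W_G(t)`: the sum over all colorings of `t` to the number of white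
vertices that have an even number of black neighbours, counted with multiplicity. -/
def bwPoly [Fintype V] [DecidableEq V] [Fintype H] (G : Multigraph V H) : Polynomial ℤ :=
  ∑ c : V → ZMod 2,
    Polynomial.X ^ (Finset.univ.filter fun v => c v = 0 ∧ Even (G.blackDegree c v)).card

/-- Two vertices are adjacent if an edge joins them. -/
def Adj (G : Multigraph V H) (a b : V) : Prop :=
  ∃ h, G.vert h = a ∧ G.vert (G.flip h) = b

/-- A multigraph is connected if it has a vertex and any two vertices are joined by a path. -/
def Connected (G : Multigraph V H) : Prop :=
  Nonempty V ∧ ∀ a b : V, Relation.ReflTransGen G.Adj a b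

/-- `G` has profile `n = (n₁, n₂, …)` if it has exactly `n k` vertices of degree `k` for all
`k ≥ 1`, and no others, that is, no vertices of degree `0`. -/
def HasProfile [Fintype V] [DecidableEq V] [Fintype H] (G : Multigraph V H) (n : ℕ+ →₀ ℕ) : Prop :=
  (∀ v, 0 < G.degree v) ∧
    ∀ k : ℕ+, (Finset.univ.filter fun v => G.degree v = (k : ℕ)).card = n k

/-- The automorphism group of `G`: the pairs of a permutation of the vertices and a permutation of
the half-edges that are compatible with the attachment and with the pairing of the half-edges. It
contains the permutations of parallel edges and the flips of loops. -/
def aut (G : Multigraph V H) : Subgroup (Equiv.Perm V × Equiv.Perm H) where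
  carrier := {σ | (∀ h, G.vert (σ.2 h) = σ.1 (G.vert h)) ∧ ∀ h, G.flip (σ.2 h) = σ.2 (G.flip h)}
  one_mem' := by simp
  mul_mem' := by
    rintro σ τ ⟨h1, h2⟩ ⟨h3, h4⟩
    constructor <;> intro h <;> simp [*]
  inv_mem' := by
    rintro σ ⟨h1, h2⟩
    refine ⟨fun h => ?_, fun h => ?_⟩
    · have := h1 (σ.2⁻¹ h)
      rw [← Equiv.Perm.mul_apply, mul_inv_cancel, Equiv.Perm.one_apply] at this
      simp [this]
    · have := h2 (σ.2⁻¹ h)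
      rw [← Equiv.Perm.mul_apply, mul_inv_cancel, Equiv.Perm.one_apply] at this
      simp [this]

/-- An isomorphism of multigraphs. -/
structure Iso (G : Multigraph V H) (G' : Multigraph V' H') where
  vEquiv : V ≃ V'
  hEquiv : H ≃ H'
  vert_comm : ∀ h, G'.vert (hEquiv h) = vEquiv (G.vert h)
  flip_comm : ∀ h, G'.flip (hEquiv h) = hEquiv (G.flip h)

namespace Iso

variable {G : Multigraph V H} {G' : Multigraph V' H'} {G'' : Multigraph V'' H''}

def refl (G : Multigraph V H) : Iso G G := ⟨Equiv.refl _, Equiv.refl _, by simp, by simp⟩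

def symm (e : Iso G G') : Iso G' G :=
  ⟨e.vEquiv.symm, e.hEquiv.symm,
    fun h => by
      have := e.vert_comm (e.hEquiv.symm h)
      simp only [Equiv.apply_symm_apply] at this
      simp [this],
    fun h => by
      have := e.flip_comm (e.hEquiv.symm h)
      simp only [Equiv.apply_symm_apply] at this
      simp [this]⟩

def trans (e : Iso G G') (f : Iso G' G'') : Iso G G'' :=
  ⟨e.vEquiv.trans f.vEquiv, e.hEquiv.trans f.hEquiv,
    fun h => by simp [e.vert_comm, f.vert_comm],
    fun h => by simp [e.flip_comm, f.flip_comm]⟩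

theorem degree_eq [DecidableEq V] [Fintype H] [DecidableEq V'] [Fintype H'] (e : Iso G G') (v : V) :
    G'.degree (e.vEquiv v) = G.degree v := by
  unfold degree
  symm
  apply Finset.card_equiv e.hEquiv
  intro h
  simp [e.vert_comm]

theorem blackDegree_eq [DecidableEq V] [Fintype H] [DecidableEq V'] [Fintype H'] (e : Iso G G')
    (c : V' → ZMod 2) (v : V) :
    G'.blackDegree c (e.vEquiv v) = G.blackDegree (c ∘ e.vEquiv) v := by
  unfold blackDegree
  symm
  apply Finset.card_equiv e.hEquiv
  intro h
  simp [e.vert_comm, e.flip_comm]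

theorem bwPoly_eq [Fintype V] [DecidableEq V] [Fintype H] [Fintype V'] [DecidableEq V']
    [Fintype H'] (e : Iso G G') : G.bwPoly = G'.bwPoly := by
  unfold bwPoly
  symm
  apply Fintype.sum_equiv (e.vEquiv.arrowCongr (Equiv.refl (ZMod 2))).symm
  intro c
  congr 1
  symm
  apply Finset.card_equiv e.vEquiv
  intro v
  simp only [Finset.mem_filter, Finset.mem_univ, true_and, e.blackDegree_eq]
  rfl

theorem hasProfile [Fintype V] [DecidableEq V] [Fintype H] [Fintype V'] [DecidableEq V']
    [Fintype H'] (e : Iso G G') {n : ℕ+ →₀ ℕ} (hG : G.HasProfile n) : G'.HasProfile n := by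
  refine ⟨fun v => ?_, fun k => ?_⟩
  · have := hG.1 (e.symm.vEquiv v)
    rwa [e.symm.degree_eq] at this
  · rw [← hG.2 k]
    apply Finset.card_equiv e.symm.vEquiv
    intro v
    simp [e.symm.degree_eq]

theorem connected (e : Iso G G') (hG : G.Connected) : G'.Connected := by
  refine ⟨hG.1.map e.vEquiv, fun a b => ?_⟩
  have := hG.2 (e.symm.vEquiv a) (e.symm.vEquiv b)
  have h2 := this.lift (p := G'.Adj) e.vEquiv (fun x y hxy => by
    obtain ⟨h, h1, h2⟩ := hxy
    exact ⟨e.hEquiv h, by rw [e.vert_comm, h1], by rw [e.flip_comm, e.vert_comm, h2]⟩)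
  simpa [symm, Function.onFun] using h2

theorem card_aut_eq (e : Iso G G') : Nat.card G.aut = Nat.card G'.aut := by
  refine Nat.card_congr
    ((Equiv.prodCongr e.vEquiv.permCongr e.hEquiv.permCongr).subtypeEquiv ?_)
  rintro ⟨σ, τ⟩
  change ((∀ h, G.vert (τ h) = σ (G.vert h)) ∧ ∀ h, G.flip (τ h) = τ (G.flip h)) ↔
    ((∀ h, G'.vert (e.hEquiv (τ (e.hEquiv.symm h))) = e.vEquiv (σ (e.vEquiv.symm (G'.vert h)))) ∧
      ∀ h, G'.flip (e.hEquiv (τ (e.hEquiv.symm h))) = e.hEquiv (τ (e.hEquiv.symm (G'.flip h))))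
  refine and_congr ?_ ?_
  · rw [← e.hEquiv.forall_congr_right]
    simp [e.vert_comm]
  · rw [← e.hEquiv.forall_congr_right]
    simp [e.flip_comm]

end Iso

end Multigraph

/-! ### Isomorphism classes of finite multigraphs -/

/-- The finite multigraphs whose vertices and half-edges are numbered. -/
abbrev FinMultigraph : Type := Σ s : ℕ × ℕ, Multigraph (Fin s.1) (Fin s.2)

/-- Every finite multigraph is isomorphic to one with numbered vertices and half-edges. -/
theorem exists_iso_finMultigraph {V H : Type*} [Finite V] [Finite H] (G : Multigraph V H) :
    ∃ G' : FinMultigraph, Nonempty (G.Iso G'.2) := by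
  obtain ⟨v, ⟨e⟩⟩ := Finite.exists_equiv_fin V
  obtain ⟨m, ⟨f⟩⟩ := Finite.exists_equiv_fin H
  exact ⟨⟨(v, m),
    ⟨fun h => e (G.vert (f.symm h)), fun h => f (G.flip (f.symm h)),
      fun h => by simp [G.flip_flip],
      fun h hh => G.flip_ne (f.symm h) (f.eq_symm_apply.2 hh)⟩⟩,
    ⟨⟨e, f, fun h => by simp, fun h => by simp⟩⟩⟩

instance isoSetoid : Setoid FinMultigraph where
  r G G' := Nonempty (G.2.Iso G'.2)
  iseqv :=
    ⟨fun G => ⟨Multigraph.Iso.refl G.2⟩, fun ⟨e⟩ => ⟨e.symm⟩, fun ⟨e⟩ ⟨f⟩ => ⟨e.trans f⟩⟩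

/-- The isomorphism classes of finite multigraphs. -/
abbrev GraphClass : Type := Quotient isoSetoid

namespace GraphClass

/-- `W_G(t)`. -/
def bwPoly : GraphClass → Polynomial ℤ :=
  Quotient.lift (fun G => G.2.bwPoly) fun _ _ ⟨e⟩ => e.bwPoly_eq

/-- `|Aut G|`. -/
def cardAut : GraphClass → ℕ :=
  Quotient.lift (fun G => Nat.card G.2.aut) fun _ _ ⟨e⟩ => e.card_aut_eq

def Connected : GraphClass → Prop :=
  Quotient.lift (fun G => G.2.Connected) fun _ _ ⟨e⟩ =>
    propext ⟨e.connected, e.symm.connected⟩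

def HasProfile (n : ℕ+ →₀ ℕ) : GraphClass → Prop :=
  Quotient.lift (fun G => G.2.HasProfile n) fun _ _ ⟨e⟩ =>
    propext ⟨e.hasProfile, e.symm.hasProfile⟩

end GraphClass

/-- `G(n)`: the multigraphs of profile `n`, up to isomorphism. -/
def graphs (n : ℕ+ →₀ ℕ) : Set GraphClass := {G | G.HasProfile n}

/-- `G_c(n)`: the connected multigraphs of profile `n`, up to isomorphism. -/
def connectedGraphs (n : ℕ+ →₀ ℕ) : Set GraphClass := {G | G.HasProfile n ∧ G.Connected}

/-- `|n| = ∑ k n_k`. -/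
def profileSize (n : ℕ+ →₀ ℕ) : ℕ := n.sum fun k m => (k : ℕ) * m

/-! ### The graph series -/

/-- The coefficient ring `ℚ[t, ξ₁, ξ₂, …] = ℚ[t][ξ₁, ξ₂, …]`. -/
abbrev Coeff : Type := MvPolynomial ℕ+ (Polynomial ℚ)

/-- The indeterminate `t`. -/
def t : Coeff := MvPolynomial.C Polynomial.X

/-- The indeterminate `ξ_k`. -/
def ξ (k : ℕ+) : Coeff := MvPolynomial.X k

/-- `W_G(t) ∏ₖ ξ_k ^ n_k / |Aut G|`. -/
def graphTerm (n : ℕ+ →₀ ℕ) (G : GraphClass) : Coeff :=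
  ((G.cardAut : ℚ)⁻¹) • (Polynomial.aeval t G.bwPoly * n.prod fun k m => ξ k ^ m)

/-- `∑ₙ u^|n| ∑_{G ∈ 𝒢(n)} W_G(t) ∏ₖ ξ_k ^ n_k / |Aut G|` for sets `𝒢(n)` of graphs, as a power
series in `u`: its coefficient at `u ^ d` is the sum over all profiles `n` with `|n| = d`. -/
def graphSeries (𝒢 : (ℕ+ →₀ ℕ) → Set GraphClass) : PowerSeries Coeff :=
  PowerSeries.mk fun d => ∑ᶠ n ∈ {n : ℕ+ →₀ ℕ | profileSize n = d}, ∑ᶠ G ∈ 𝒢 n, graphTerm n G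

/-- The generating function `𝓑(u)` of the black-white polynomials of all connected graphs. -/
def connectedSeries : PowerSeries Coeff := graphSeries connectedGraphs

/-! ### The formal measure -/

/-- The pairing variables. -/
inductive PVar
  | b | w | y | z
  deriving DecidableEq

/-- The Wick number `n! / (2^(n/2) (n/2)!)` for even `n`, and `0` for odd `n`. -/
def wick (n : ℕ) : ℚ :=
  if Even n then (n.factorial : ℚ) / (2 ^ (n / 2) * ((n / 2).factorial : ℚ)) else 0

/-- The value `⟨bⁿ wᵐ yᵏ zˡ⟩ = ⟨bⁿ⟩ ⟨wᵐ⟩ ⟨yᵏ zˡ⟩` on a monomial, given by its exponents. -/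
def moment (m : PVar →₀ ℕ) : ℚ :=
  wick (m .b) * wick (m .w) * (if m .y = m .z then ((m .y).factorial : ℚ) else 0)

/-- The linear functional `⟨·⟩_bw` on the polynomials in `b, w, y, z` over a `ℚ`-algebra `R`. -/
def expect (R : Type*) [CommRing R] [Algebra ℚ R] : MvPolynomial PVar R →ₗ[R] R :=
  (MvPolynomial.basisMonomials PVar R).constr R fun m => algebraMap ℚ R (moment m)

theorem expect_monomial (R : Type*) [CommRing R] [Algebra ℚ R] (m : PVar →₀ ℕ) (r : R) :
    expect R (MvPolynomial.monomial m r) = r * algebraMap ℚ R (moment m) := by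
  have h : MvPolynomial.monomial m r = r • MvPolynomial.basisMonomials PVar R m := by
    simp [MvPolynomial.smul_monomial]
  rw [h, map_smul, expect, Module.Basis.constr_basis, smul_eq_mul]

/-- `⟨·⟩_bw` on power series in `u`, coefficient by coefficient. -/
def expectSeries (f : PowerSeries (MvPolynomial PVar Coeff)) : PowerSeries Coeff :=
  PowerSeries.mk fun d => expect Coeff (PowerSeries.coeff d f)

/-! ### The series `S(u)` -/

/-- `p(i)`: `t` if `i` is even, and `1` if `i` is odd. -/
def p (i : ℕ) : Coeff := if Even i then t else 1

open MvPolynomial in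
/-- `F(n) = (b + y)ⁿ + ∑ᵢ (n choose i) p(i) w^(n-i) zⁱ`. -/
def flower (n : ℕ) : MvPolynomial PVar Coeff :=
  (X PVar.b + X PVar.y) ^ n +
    ∑ i ∈ Finset.range (n + 1), (n.choose i : MvPolynomial PVar Coeff) * C (p i) *
      X PVar.w ^ (n - i) * X PVar.z ^ i

/-- `S(u) = ∑_{k ≥ 1} F(k) ξ_k u^k / k!`. -/
def S : PowerSeries (MvPolynomial PVar Coeff) :=
  PowerSeries.mk fun k =>
    if hk : 0 < k then ((k.factorial : ℚ)⁻¹) • (flower k * MvPolynomial.C (ξ ⟨k, hk⟩)) else 0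

theorem constantCoeff_S : PowerSeries.constantCoeff S = 0 := by
  rw [← PowerSeries.coeff_zero_eq_constantCoeff_apply]
  simp [S]

/-- `exp S(u)` is a legitimate substitution. -/
theorem hasSubst_S : PowerSeries.HasSubst S :=
  PowerSeries.HasSubst.of_constantCoeff_zero' constantCoeff_S

/-- `exp S(u)`. -/
def expS : PowerSeries (MvPolynomial PVar Coeff) := (PowerSeries.exp ℚ).subst S

end BW

end

/-! Numbering the vertices and the half-edges turns the sum over isomorphism classes, weighted by
`1 / |Aut G|`, into a sum over multigraphs on `Fin v` and `Fin d`, weighted by `1 / (v! d!)`: an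
exponential generating function in the number of half-edges.

In `exp S(u)`, a product of flowers is a distribution of `d` half-edges among `v` vertices in which
each half-edge `h` carries the color of its vertex and the color that its other end is to have. By
Wick's theorem, `⟨·⟩_bw` counts the pairings of the half-edges that respect these colors, and these
pairings are the multigraphs with a coloring.

For the logarithm, mark a half-edge. Its component is a connected multigraph with a marked half-edge
and the rest is arbitrary, so the series `T` of all multigraphs and the series `C` of the connected
ones satisfy `u T' = u C' T`, that is, `C = log T`. -/

noncomputable section

namespace BW

open Finset

open scoped Nat

/-! ### Exponential generating functions -/

section ExponentialGeneratingFunctions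

open PowerSeries

variable {R : Type*} [CommRing R] [Algebra ℚ R]

/-- The exponential generating function `∑ aₙ uⁿ / n!` of a sequence. -/
def egf (a : ℕ → R) : PowerSeries R := PowerSeries.mk fun n => (n ! : ℚ)⁻¹ • a n

theorem coeff_egf (a : ℕ → R) (n : ℕ) : coeff n (egf a) = (n ! : ℚ)⁻¹ • a n := coeff_mk _ _

theorem X_mul_derivative_egf (a : ℕ → R) :
    X * derivative R (egf a) = egf fun n => n • a n := by
  ext n
  cases n with
  | zero => simp [coeff_egf]
  | succ n =>
    rw [coeff_succ_X_mul, coeff_derivative, coeff_egf, coeff_egf,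
      ← Nat.cast_smul_eq_nsmul ℚ (n + 1), smul_mul_assoc, ← Nat.cast_succ, mul_comm,
      ← nsmul_eq_mul, ← Nat.cast_smul_eq_nsmul ℚ]

theorem sum_card_card_compl {M : Type*} [AddCommMonoid M] [Module ℚ M] (V : Type*) [Fintype V]
    [DecidableEq V] (F : ℕ → ℕ → M) :
    ((Fintype.card V)! : ℚ)⁻¹ • ∑ s : Finset V, F #s #sᶜ =
      ∑ x ∈ antidiagonal (Fintype.card V), ((x.1 ! : ℚ)⁻¹ * (x.2 ! : ℚ)⁻¹) • F x.1 x.2 := by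
  have h := sum_powerset_apply_card (fun i => F i (Fintype.card V - i))
    (x := (univ : Finset V))
  simp only [powerset_univ, card_univ, ← card_compl] at h
  rw [h, Nat.sum_antidiagonal_eq_sum_range_succ_mk, smul_sum]
  refine sum_congr rfl fun i hi => ?_
  have hi' : i ≤ Fintype.card V := Nat.lt_succ_iff.1 (mem_range.1 hi)
  rw [← Nat.cast_smul_eq_nsmul ℚ, smul_smul, Nat.cast_choose ℚ hi']
  congr 1
  have : ((Fintype.card V)! : ℚ) ≠ 0 := by positivity
  field_simp

theorem egf_mul_egf (a b : ℕ → R) :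
    egf a * egf b = egf fun n => ∑ s : Finset (Fin n), a #s * b #sᶜ := by
  ext n
  have h := sum_card_card_compl (Fin n) fun i j => a i * b j
  simp only [Fintype.card_fin] at h
  simp only [coeff_mul, coeff_egf, h, smul_mul_smul_comm]

theorem card_fiber_eq_multinomial {H V : Type*} [Fintype H] [Fintype V] [DecidableEq V]
    [DecidableEq H] {k : V → ℕ} (hk : ∑ i, k i = Fintype.card H) :
    #{f : H → V | (fun i => #{h | f h = i}) = k} = Nat.multinomial univ k := by
  have expand := congrArg (MvPolynomial.coeff (Finsupp.equivFunOnFinite.symm k))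
    (sum_pow_eq_sum_piAntidiag univ (MvPolynomial.X (R := ℕ) (σ := V)) (Fintype.card H))
  have left : ∀ f : H → V, ∏ h, MvPolynomial.X (R := ℕ) (f h) =
      MvPolynomial.monomial (Finsupp.equivFunOnFinite.symm fun i => #{h | f h = i}) 1 := fun f => by
    rw [MvPolynomial.monomial_eq, map_one, one_mul, Finsupp.prod_fintype _ _ (by simp),
      ← prod_fiberwise' univ f]
    simp only [prod_const]
    rfl
  have right : ∀ m : V → ℕ, ∏ i, MvPolynomial.X (R := ℕ) i ^ m i =
      MvPolynomial.monomial (Finsupp.equivFunOnFinite.symm m) 1 := fun m => by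
    rw [MvPolynomial.monomial_eq, map_one, one_mul, Finsupp.prod_fintype _ _ (by simp)]
    rfl
  rw [← card_univ, ← prod_const, Fintype.prod_sum] at expand
  simp only [left, right, MvPolynomial.coeff_sum, ← nsmul_eq_mul, MvPolynomial.coeff_smul,
    MvPolynomial.coeff_monomial, EmbeddingLike.apply_eq_iff_eq, sum_boole, card_univ] at expand
  simpa [hk] using expand

theorem prod_egf {V : Type*} [Fintype V] [DecidableEq V] (g : V → ℕ → R) :
    ∏ i, egf (g i) = egf fun d => ∑ f : Fin d → V, ∏ i, g i #{h | f h = i} := by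
  ext d
  have group : ∑ f : Fin d → V, ∏ i, g i #{h | f h = i} =
      ∑ k ∈ univ.piAntidiag d, Nat.multinomial univ k • ∏ i, g i (k i) := by
    rw [← sum_fiberwise_of_maps_to (t := univ.piAntidiag d) (g := fun f i => #{h | f h = i})]
    · refine sum_congr rfl fun k hk => ?_
      rw [← card_fiber_eq_multinomial (H := Fin d) (by simpa using hk), ← sum_const]
      refine sum_congr rfl fun f hf => ?_
      simp [← (mem_filter.1 hf).2]
    · intro f _
      simpa using (card_eq_sum_card_fiberwise (s := univ) (t := univ) (f := f) (by simp)).symm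
  rw [coeff_prod, coeff_egf, group, smul_sum]
  refine sum_equiv Finsupp.equivFunOnFinite (fun k => by simp) fun k hk => ?_
  have h_fact : (∏ i, (k i)! : ℚ) * Nat.multinomial univ k = d ! := by
    rw [← (mem_finsuppAntidiag.1 hk).1, ← Nat.multinomial_spec]
    push_cast
    rfl
  have h_ne : (∏ i, (k i)! : ℚ) ≠ 0 := prod_ne_zero_iff.2 fun i _ => by positivity
  have h_ne' : (d ! : ℚ) ≠ 0 := by positivity
  simp only [coeff_egf, prod_smul, Finsupp.equivFunOnFinite_apply]
  rw [← Nat.cast_smul_eq_nsmul ℚ, smul_smul, prod_inv_distrib]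
  congr 1
  field_simp
  exact h_fact.symm

theorem coeff_exp_subst {f : PowerSeries R} (hf : constantCoeff f = 0) (d : ℕ) :
    coeff d ((PowerSeries.exp ℚ).subst f) =
      ∑ v ∈ range (d + 1), (v ! : ℚ)⁻¹ • coeff d (f ^ v) := by
  rw [coeff_subst' (HasSubst.of_constantCoeff_zero' hf),
    finsum_eq_sum_of_support_subset (s := range (d + 1))]
  · simp [coeff_exp]
  · intro v hv
    rw [coe_range, Set.mem_Iio]
    by_contra! h
    have h_dvd : X ^ v ∣ f ^ v := pow_dvd_pow_of_dvd (X_dvd_iff.2 hf) v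
    exact hv (by beta_reduce; rw [X_pow_dvd_iff.1 h_dvd d (by lia), smul_zero])

theorem coeff_exp_subst_egf {g : ℕ → R} (hg : g 0 = 0) (d : ℕ) :
    coeff d ((PowerSeries.exp ℚ).subst (egf g)) =
      ∑ v ∈ range (d + 1), ((v ! : ℚ)⁻¹ * (d ! : ℚ)⁻¹) •
        ∑ f : Fin d → Fin v, ∏ i, g #{h | f h = i} := by
  rw [coeff_exp_subst (by rw [← coeff_zero_eq_constantCoeff_apply, coeff_egf, hg, smul_zero])]
  refine sum_congr rfl fun v _ => ?_
  have h_pow : egf g ^ v = ∏ _i : Fin v, egf g := by simp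
  rw [h_pow, prod_egf, coeff_egf, smul_smul]

theorem derivative_log_mul_one_add_X : derivative R (PowerSeries.log R) * (1 + X) = 1 := by
  rw [deriv_log]
  ext n
  rw [mul_add, mul_one, map_add]
  cases n with
  | zero => simp
  | succ n => simp [coeff_succ_mul_X, coeff_one, pow_succ]

theorem derivative_logOf_mul {f : PowerSeries R} (hf : constantCoeff f = 1) :
    derivative R (logOf f) * f = derivative R f := by
  have hs : HasSubst (f - 1) := HasSubst.of_constantCoeff_zero' (by simp [hf])
  have h := congrArg (PowerSeries.subst (f - 1)) (derivative_log_mul_one_add_X (R := R))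
  rw [subst_mul hs, subst_add hs, subst_X hs, ← coe_substAlgHom hs, map_one, add_sub_cancel] at h
  rw [logOf_eq, derivative_subst hs, mul_right_comm, ← coe_substAlgHom hs, h, one_mul,
    map_sub, derivative_one, sub_zero]

theorem eq_logOf_of_derivative {f g : PowerSeries R} (hf : constantCoeff f = 1)
    (hg : constantCoeff g = 0) (h : derivative R f = derivative R g * f) : g = logOf f := by
  have := IsAddTorsionFree.of_module_rat R
  refine derivative.ext ?_ (by rw [hg, constantCoeff_logOf hf])
  have hu : IsUnit f := isUnit_iff_constantCoeff.2 (hf ▸ isUnit_one)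
  exact hu.mul_right_cancel (by rw [← h, derivative_logOf_mul hf])

end ExponentialGeneratingFunctions

/-! ### Multigraphs with numbered vertices and half-edges -/

namespace Multigraph

variable {V H V' H' : Type*}

instance [Finite V] [Finite H] : Finite (Multigraph V H) :=
  Finite.of_injective (fun G : Multigraph V H => (G.vert, G.flip)) fun _ _ h =>
    Multigraph.ext (congrArg Prod.fst h) (congrArg Prod.snd h)

instance [Finite V] [Finite H] : Fintype (Multigraph V H) := Fintype.ofFinite _

/-- Transport of a multigraph along bijections of the vertices and of the half-edges. -/
@[simps] def relabel (e : V ≃ V') (f : H ≃ H') : Multigraph V H ≃ Multigraph V' H' where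
  toFun G := ⟨e ∘ G.vert ∘ f.symm, f ∘ G.flip ∘ f.symm, fun h => by simp [G.flip_flip],
    fun h hh => G.flip_ne (f.symm h) (f.eq_symm_apply.2 hh)⟩
  invFun G := ⟨e.symm ∘ G.vert ∘ f, f.symm ∘ G.flip ∘ f, fun h => by simp [G.flip_flip],
    fun h hh => G.flip_ne (f h) (f.symm_apply_eq.1 hh)⟩
  left_inv G := by ext <;> simp
  right_inv G := by ext <;> simp

/-- The isomorphism of a multigraph with its transport. -/
def isoRelabel (e : V ≃ V') (f : H ≃ H') (G : Multigraph V H) : G.Iso (relabel e f G) :=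
  ⟨e, f, fun h => by simp, fun h => by simp⟩

theorem relabel_eq_iff (e : V ≃ V') (f : H ≃ H') {G : Multigraph V H} {G' : Multigraph V' H'} :
    relabel e f G = G' ↔
      (∀ h, G'.vert (f h) = e (G.vert h)) ∧ ∀ h, G'.flip (f h) = f (G.flip h) := by
  rw [← Equiv.eq_symm_apply, Multigraph.ext_iff]
  simp [funext_iff, Equiv.eq_symm_apply, eq_comm]

instance : MulAction (Equiv.Perm V × Equiv.Perm H) (Multigraph V H) where
  smul σ := relabel σ.1 σ.2
  one_smul _ := rfl
  mul_smul _ _ _ := rfl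

theorem stabilizer_eq_aut (G : Multigraph V H) :
    MulAction.stabilizer (Equiv.Perm V × Equiv.Perm H) G = G.aut :=
  SetLike.ext fun σ => relabel_eq_iff σ.1 σ.2

theorem mem_orbit_iff {G G' : Multigraph V H} :
    G' ∈ MulAction.orbit (Equiv.Perm V × Equiv.Perm H) G ↔ Nonempty (G.Iso G') :=
  ⟨fun ⟨σ, hσ⟩ => ⟨σ.1, σ.2, ((relabel_eq_iff _ _).1 hσ).1, ((relabel_eq_iff _ _).1 hσ).2⟩,
    fun ⟨e⟩ => ⟨(e.vEquiv, e.hEquiv), (relabel_eq_iff _ _).2 ⟨e.vert_comm, e.flip_comm⟩⟩⟩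

theorem card_iso_mul_card_aut [Finite V] [Finite H] (G : Multigraph V H) :
    Nat.card {G' : Multigraph V H // Nonempty (G.Iso G')} * Nat.card G.aut =
      (Nat.card V)! * (Nat.card H)! := by
  have h := Nat.card_congr (MulAction.orbitProdStabilizerEquivGroup
    (Equiv.Perm V × Equiv.Perm H) G)
  rw [Nat.card_prod, Nat.card_prod, stabilizer_eq_aut, Nat.card_perm, Nat.card_perm] at h
  rw [← h, ← Nat.card_congr (Equiv.subtypeEquivRight fun _ => mem_orbit_iff)]

/-- The isomorphism class of a finite multigraph. -/
def toClass [Finite V] [Finite H] (G : Multigraph V H) : GraphClass :=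
  ⟦(exists_iso_finMultigraph G).choose⟧

theorem exists_toClass_eq_mk [Finite V] [Finite H] (G : Multigraph V H) :
    ∃ G' : FinMultigraph, G.toClass = ⟦G'⟧ ∧ Nonempty (G.Iso G'.2) :=
  ⟨_, rfl, (exists_iso_finMultigraph G).choose_spec⟩

theorem toClass_eq_iff [Finite V] [Finite H] [Finite V'] [Finite H'] {G : Multigraph V H}
    {G' : Multigraph V' H'} : G.toClass = G'.toClass ↔ Nonempty (G.Iso G') := by
  obtain ⟨F, hF, ⟨e⟩⟩ := G.exists_toClass_eq_mk
  obtain ⟨F', hF', ⟨e'⟩⟩ := G'.exists_toClass_eq_mk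
  rw [hF, hF']
  exact Quotient.eq.trans
    ⟨fun ⟨f⟩ => ⟨(e.trans f).trans e'.symm⟩, fun ⟨f⟩ => ⟨(e.symm.trans f).trans e'⟩⟩

theorem cardAut_toClass [Finite V] [Finite H] (G : Multigraph V H) :
    G.toClass.cardAut = Nat.card G.aut := by
  obtain ⟨F, hF, ⟨e⟩⟩ := G.exists_toClass_eq_mk
  rw [hF, e.card_aut_eq]
  rfl

theorem connected_toClass [Finite V] [Finite H] {G : Multigraph V H} :
    G.toClass.Connected ↔ G.Connected := by
  obtain ⟨F, hF, ⟨e⟩⟩ := G.exists_toClass_eq_mk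
  rw [hF]
  exact ⟨e.symm.connected, e.connected⟩

theorem toClass_mem_graphs [Fintype V] [DecidableEq V] [Fintype H] {G : Multigraph V H}
    {n : ℕ+ →₀ ℕ} : G.toClass ∈ graphs n ↔ G.HasProfile n := by
  obtain ⟨F, hF, ⟨e⟩⟩ := G.exists_toClass_eq_mk
  rw [hF]
  exact ⟨e.symm.hasProfile, e.hasProfile⟩

theorem bwPoly_toClass [Fintype V] [DecidableEq V] [Fintype H] (G : Multigraph V H) :
    G.toClass.bwPoly = G.bwPoly := by
  obtain ⟨F, hF, ⟨e⟩⟩ := G.exists_toClass_eq_mk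
  rw [hF, e.bwPoly_eq]
  rfl

end Multigraph

theorem GraphClass.exists_toClass (q : GraphClass) :
    ∃ (v d : ℕ) (G : Multigraph (Fin v) (Fin d)), G.toClass = q := by
  induction q using Quotient.inductionOn with | _ G
  obtain ⟨F, hF, hGF⟩ := G.2.exists_toClass_eq_mk
  exact ⟨_, _, G.2, hF.trans (Quotient.sound hGF).symm⟩

section LabelledSum

variable {M : Type*} [AddCommMonoid M]

/-- The sum of an isomorphism invariant over all multigraphs with `v` numbered vertices and `d`
numbered half-edges. -/
def labelledSum (w : GraphClass → M) (v d : ℕ) : M :=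
  ∑ G : Multigraph (Fin v) (Fin d), w G.toClass

theorem sum_toClass {V H : Type*} [Finite V] [Finite H] (w : GraphClass → M) :
    ∑ G : Multigraph V H, w G.toClass = labelledSum w (Nat.card V) (Nat.card H) :=
  Fintype.sum_equiv (Multigraph.relabel (Finite.equivFin V) (Finite.equivFin H)) _ _ fun G =>
    congrArg w (Multigraph.toClass_eq_iff.2 ⟨G.isoRelabel _ _⟩)

open Classical in
theorem sum_image_toClass [Module ℚ M] (w : GraphClass → M) (v d : ℕ) :
    ∑ q ∈ univ.image (Multigraph.toClass (V := Fin v) (H := Fin d)), (q.cardAut : ℚ)⁻¹ • w q =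
      ((v ! : ℚ)⁻¹ * (d ! : ℚ)⁻¹) • labelledSum w v d := by
  rw [labelledSum, sum_comp w, smul_sum]
  refine sum_congr rfl fun q hq => ?_
  obtain ⟨G, -, rfl⟩ := mem_image.1 hq
  have h_fiber : #{G' : Multigraph (Fin v) (Fin d) | G'.toClass = G.toClass} =
      Nat.card {G' : Multigraph (Fin v) (Fin d) // Nonempty (G.Iso G')} := by
    simp [Nat.card_eq_fintype_card, Fintype.card_subtype, eq_comm (b := G.toClass),
      Multigraph.toClass_eq_iff]
  have h_card := G.card_iso_mul_card_aut
  rw [← h_fiber, Nat.card_fin, Nat.card_fin] at h_card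
  rw [G.cardAut_toClass, ← Nat.cast_smul_eq_nsmul ℚ, smul_smul]
  congr 1
  have h_ne : (Nat.card G.aut : ℚ) ≠ 0 := Nat.cast_ne_zero.2 Nat.card_pos.ne'
  rw [← mul_inv, ← Nat.cast_mul (v !), ← h_card]
  push_cast
  field_simp

open Classical in
/-- The isomorphism classes of the multigraphs with `d` half-edges and at most `d` vertices. They
include all multigraphs with `d` half-edges and no isolated vertices. -/
def classesOfSize (d : ℕ) : Finset GraphClass :=
  (range (d + 1)).biUnion fun v => univ.image (Multigraph.toClass (V := Fin v) (H := Fin d))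

theorem toClass_mem_classesOfSize {V H : Type*} [Fintype V] [Fintype H] {G : Multigraph V H}
    {d : ℕ} : G.toClass ∈ classesOfSize d ↔ Fintype.card H = d ∧ Fintype.card V ≤ d := by
  simp only [classesOfSize, mem_biUnion, mem_range, Nat.lt_succ_iff, mem_image, mem_univ, true_and,
    Multigraph.toClass_eq_iff]
  constructor
  · rintro ⟨v, hv, G', ⟨e⟩⟩
    simpa [← Fintype.card_congr e.vEquiv, ← Fintype.card_congr e.hEquiv] using hv
  · rintro ⟨rfl, hv⟩
    exact ⟨_, hv, _, ⟨(G.isoRelabel (Fintype.equivFin V) (Fintype.equivFin H)).symm⟩⟩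

theorem sum_classesOfSize [Module ℚ M] (w : GraphClass → M) (d : ℕ) :
    ∑ q ∈ classesOfSize d, (q.cardAut : ℚ)⁻¹ • w q =
      ∑ v ∈ range (d + 1), ((v ! : ℚ)⁻¹ * (d ! : ℚ)⁻¹) • labelledSum w v d := by
  classical
  rw [classesOfSize, sum_biUnion]
  · exact sum_congr rfl fun v _ => by rw [← sum_image_toClass]
  · intro v _ v' _ hvv'
    refine disjoint_left.2 fun q hq hq' => hvv' ?_
    obtain ⟨G, -, rfl⟩ := mem_image.1 hq
    obtain ⟨G', -, hG'⟩ := mem_image.1 hq'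
    obtain ⟨e⟩ := Multigraph.toClass_eq_iff.1 hG'
    simpa using (Fintype.card_congr e.vEquiv).symm

end LabelledSum

/-! ### Profiles and graph series -/

theorem finite_profileSize_eq (d : ℕ) : {n : ℕ+ →₀ ℕ | profileSize n = d}.Finite := by
  let parts (n : ℕ+ →₀ ℕ) : Multiset ℕ := (Finsupp.toMultiset n).map (↑)
  have parts_injective : parts.Injective :=
    (Multiset.map_injective PNat.coe_injective).comp Multiset.toFinsupp.symm.injective
  refine ((Set.finite_range (Nat.Partition.parts (n := d))).preimage
    parts_injective.injOn).subset fun n hn => ⟨⟨parts n, ?_, ?_⟩, rfl⟩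
  · intro i hi
    obtain ⟨k, -, rfl⟩ := Multiset.mem_map.1 hi
    exact k.pos
  · rw [← (show profileSize n = d from hn), profileSize]
    simp only [parts, Finsupp.toMultiset_map, Finsupp.sum_toMultiset]
    rw [Finsupp.sum_mapDomain_index (by simp) fun _ _ _ => add_mul _ _ _]
    exact Finsupp.sum_congr fun k _ => mul_comm _ _

/-- The indeterminate `ξ_k`, with `ξ_0 = 0`. -/
def degVar (k : ℕ) : Coeff := if hk : 0 < k then ξ ⟨k, hk⟩ else 0

theorem degVar_zero : degVar 0 = 0 := dif_neg (lt_irrefl 0)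

theorem degVar_of_pos {k : ℕ} (hk : 0 < k) : degVar k = ξ k.toPNat' := by
  rw [degVar, dif_pos hk]
  exact congrArg ξ (PNat.eq ((Nat.toPNat'_coe k).trans (if_pos hk)).symm)

namespace Multigraph

variable {V H : Type*} [Fintype V] [DecidableEq V] [Fintype H]

theorem sum_degree (G : Multigraph V H) : ∑ v, G.degree v = Fintype.card H :=
  (card_eq_sum_card_fiberwise fun _ _ => mem_univ _).symm

/-- The numbers of vertices of each positive degree, provided that there are no isolated vertices:
an isolated vertex is counted as a vertex of degree `1`. -/
def profile (G : Multigraph V H) : ℕ+ →₀ ℕ := ∑ v, Finsupp.single (G.degree v).toPNat' 1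

theorem hasProfile_iff {G : Multigraph V H} {n : ℕ+ →₀ ℕ} :
    G.HasProfile n ↔ (∀ v, 0 < G.degree v) ∧ G.profile = n := by
  refine and_congr_right fun hG => (forall_congr' fun k => ?_).trans Finsupp.ext_iff.symm
  have h_iff (v : V) : (G.degree v).toPNat' = k ↔ G.degree v = k := by
    rw [← PNat.coe_inj, Nat.toPNat'_coe, if_pos (hG v)]
  simp [profile, Finsupp.finsetSum_apply, Finsupp.single_apply, h_iff]

theorem HasProfile.profileSize_eq {G : Multigraph V H} {n : ℕ+ →₀ ℕ} (hG : G.HasProfile n) :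
    profileSize n = Fintype.card H := by
  obtain ⟨h_pos, rfl⟩ := hasProfile_iff.1 hG
  rw [← G.sum_degree, profileSize, profile,
    ← Finsupp.sum_finsetSum_index (by simp) fun _ _ _ => mul_add _ _ _]
  refine sum_congr rfl fun v _ => ?_
  rw [Finsupp.sum_single_index (mul_zero _), mul_one, Nat.toPNat'_coe, if_pos (h_pos v)]

theorem HasProfile.prod_eq {G : Multigraph V H} {n : ℕ+ →₀ ℕ} (hG : G.HasProfile n) :
    (n.prod fun k m => ξ k ^ m) = ∏ v, degVar (G.degree v) := by
  obtain ⟨h_pos, rfl⟩ := hasProfile_iff.1 hG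
  rw [profile, ← Finsupp.prod_finsetSum_index (fun _ => pow_zero _) fun _ => pow_add _]
  refine prod_congr rfl fun v _ => ?_
  rw [Finsupp.prod_single_index (by exact pow_zero _), pow_one, degVar_of_pos (h_pos v)]

theorem HasProfile.card_le {G : Multigraph V H} {n : ℕ+ →₀ ℕ} (hG : G.HasProfile n) :
    Fintype.card V ≤ Fintype.card H := by
  rw [← G.sum_degree, ← card_univ, card_eq_sum_ones]
  exact sum_le_sum fun v _ => hG.1 v

end Multigraph

theorem graphs_subset_classesOfSize (n : ℕ+ →₀ ℕ) :
    graphs n ⊆ classesOfSize (profileSize n) := by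
  intro q hq
  obtain ⟨v, d, G, rfl⟩ := q.exists_toClass
  have hG := Multigraph.toClass_mem_graphs.1 hq
  rw [mem_coe, toClass_mem_classesOfSize, hG.profileSize_eq]
  exact ⟨rfl, hG.card_le⟩

theorem finite_graphs (n : ℕ+ →₀ ℕ) : (graphs n).Finite :=
  (finite_toSet _).subset (graphs_subset_classesOfSize n)

theorem pairwise_disjoint_graphs : Pairwise (Function.onFun Disjoint graphs) := by
  intro n n' hn
  refine Set.disjoint_left.2 fun q hq hq' => hn ?_
  obtain ⟨v, d, G, rfl⟩ := q.exists_toClass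
  rw [Multigraph.toClass_mem_graphs, Multigraph.hasProfile_iff] at hq hq'
  exact hq.2.symm.trans hq'.2

section BWWeight

variable {V H : Type*} [Fintype V] [DecidableEq V] [Fintype H]

/-- The weight `W_G(t) ∏_v ξ_{deg v}` of a multigraph. It vanishes if there are isolated
vertices. -/
def bwWeight : GraphClass → Coeff :=
  Quotient.lift
    (fun G => Polynomial.aeval t G.2.bwPoly * ∏ v, degVar (G.2.degree v)) fun _ _ ⟨e⟩ => by
      rw [e.bwPoly_eq, ← e.vEquiv.prod_comp]
      simp only [e.degree_eq]

theorem bwWeight_toClass (G : Multigraph V H) :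
    bwWeight G.toClass = Polynomial.aeval t G.bwPoly * ∏ v, degVar (G.degree v) := by
  obtain ⟨F, hF, ⟨e⟩⟩ := G.exists_toClass_eq_mk
  rw [hF, e.bwPoly_eq]
  simp only [← e.degree_eq, e.vEquiv.prod_comp fun v => degVar (F.2.degree v)]
  rfl

theorem support_bwWeight_subset : Function.support bwWeight ⊆ ⋃ n, graphs n := by
  intro q hq
  obtain ⟨v, d, G, rfl⟩ := q.exists_toClass
  refine Set.mem_iUnion.2 ⟨G.profile, Multigraph.toClass_mem_graphs.2
    (Multigraph.hasProfile_iff.2 ⟨fun v => Nat.pos_of_ne_zero fun hv => hq ?_, rfl⟩)⟩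
  rw [bwWeight_toClass, prod_eq_zero (mem_univ v) (by rw [hv, degVar_zero]), mul_zero]

theorem graphTerm_eq {n : ℕ+ →₀ ℕ} {q : GraphClass} (hq : q ∈ graphs n) :
    graphTerm n q = (q.cardAut : ℚ)⁻¹ • bwWeight q := by
  obtain ⟨v, d, G, rfl⟩ := q.exists_toClass
  rw [graphTerm, bwWeight_toClass, G.bwPoly_toClass,
    (Multigraph.toClass_mem_graphs.1 hq).prod_eq]

end BWWeight

section LabelledSeries

open PowerSeries

variable {R : Type*} [CommRing R] [Algebra ℚ R]

/-- The sum of the invariant `w` over the multigraphs with `d` numbered half-edges, up to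
renumbering the vertices. Graphs with more than `d` vertices have isolated vertices; they are left
out. -/
def halfEdgeLabelledSum (w : GraphClass → R) (d : ℕ) : R :=
  ∑ v ∈ range (d + 1), (v ! : ℚ)⁻¹ • labelledSum w v d

/-- The exponential generating function, in the number of half-edges, of the sums of the invariant
`w` over all multigraphs. -/
def labelledSeries (w : GraphClass → R) : PowerSeries R := egf (halfEdgeLabelledSum w)

theorem coeff_labelledSeries (w : GraphClass → R) (d : ℕ) :
    coeff d (labelledSeries w) = ∑ q ∈ classesOfSize d, (q.cardAut : ℚ)⁻¹ • w q := by
  rw [labelledSeries, coeff_egf, halfEdgeLabelledSum, sum_classesOfSize, smul_sum]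
  exact sum_congr rfl fun v _ => by rw [smul_smul, mul_comm]

theorem graphSeries_inter (P : Set GraphClass) :
    graphSeries (fun n => graphs n ∩ P) = labelledSeries (P.indicator bwWeight) := by
  ext1 d
  let term (q : GraphClass) : Coeff := (q.cardAut : ℚ)⁻¹ • P.indicator bwWeight q
  have h_term : ∀ n, ∀ q ∈ graphs n ∩ P, graphTerm n q = term q := fun n q hq => by
    rw [graphTerm_eq hq.1, ← Set.indicator_of_mem hq.2 bwWeight]
  have h_support : (⋃ n ∈ {n | profileSize n = d}, graphs n ∩ P) ∩ Function.support term =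
      ↑(classesOfSize d) ∩ Function.support term := by
    ext q
    simp only [Set.mem_inter_iff, Set.mem_iUnion, and_congr_left_iff, mem_coe]
    refine fun hq => ⟨?_, fun hd => ?_⟩
    · rintro ⟨n, rfl, hn, -⟩
      exact graphs_subset_classesOfSize n hn
    · have hqP : q ∈ P ∧ bwWeight q ≠ 0 := by simpa [term] using (smul_ne_zero_iff.1 hq).2
      obtain ⟨n, hn⟩ := Set.mem_iUnion.1 (support_bwWeight_subset hqP.2)
      obtain ⟨v, m, G, rfl⟩ := q.exists_toClass
      have h_size := (Multigraph.toClass_mem_graphs.1 hn).profileSize_eq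
      exact ⟨n, h_size.trans (toClass_mem_classesOfSize.1 hd).1, hn, hqP.1⟩
  rw [coeff_labelledSeries, graphSeries, coeff_mk,
    ← finsum_mem_eq_sum_of_inter_support_eq term h_support, finsum_mem_biUnion]
  · exact finsum_mem_congr rfl fun n _ => finsum_mem_congr rfl (h_term n)
  · exact fun n _ n' _ hn => (pairwise_disjoint_graphs hn).mono inf_le_left inf_le_left
  · exact finite_profileSize_eq d
  · exact fun n _ => (finite_graphs n).inter_of_left P

theorem graphSeries_graphs : graphSeries graphs = labelledSeries bwWeight := by
  simpa using graphSeries_inter Set.univ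

theorem connectedSeries_eq :
    connectedSeries = labelledSeries ({q | q.Connected}.indicator bwWeight) :=
  graphSeries_inter {q | q.Connected}

end LabelledSeries

/-! ### Components -/

namespace Multigraph

variable {V H V₁ H₁ V₂ H₂ : Type*}

/-- The disjoint union of two multigraphs. -/
@[simps] def disjointUnion (G₁ : Multigraph V₁ H₁) (G₂ : Multigraph V₂ H₂) :
    Multigraph (V₁ ⊕ V₂) (H₁ ⊕ H₂) where
  vert := Sum.map G₁.vert G₂.vert
  flip := Sum.map G₁.flip G₂.flip
  flip_flip := by rintro (h | h) <;> simp [G₁.flip_flip, G₂.flip_flip]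
  flip_ne := by rintro (h | h) <;> simp [G₁.flip_ne, G₂.flip_ne]

/-- `G` has no edges between the vertices in `s` and the others, and `u` is the set of half-edges
at `s`. -/
structure IsSplit (G : Multigraph V H) (s : Set V) (u : Set H) : Prop where
  vert_mem_iff : ∀ h, G.vert h ∈ s ↔ h ∈ u
  flip_mem_iff : ∀ h, G.flip h ∈ u ↔ h ∈ u

variable {G : Multigraph V H} {s : Set V} {u : Set H}

theorem IsSplit.compl (hG : G.IsSplit s u) : G.IsSplit sᶜ uᶜ :=
  ⟨fun h => (hG.vert_mem_iff h).not, fun h => (hG.flip_mem_iff h).not⟩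

/-- The part of `G` on the vertices in `s` and the half-edges at them. -/
@[simps] def IsSplit.restrict (hG : G.IsSplit s u) : Multigraph s u where
  vert h := ⟨G.vert h, (hG.vert_mem_iff h).2 h.2⟩
  flip h := ⟨G.flip h, (hG.flip_mem_iff h).2 h.2⟩
  flip_flip h := Subtype.ext (G.flip_flip h)
  flip_ne h hh := G.flip_ne h (congrArg Subtype.val hh)

open Classical in
/-- The multigraph with vertices `V` and half-edges `H` that is made up of a multigraph on the
vertices in `s` and one on the vertices outside `s`. -/
def glue (G₁ : Multigraph s u) (G₂ : Multigraph ↥sᶜ ↥uᶜ) : Multigraph V H :=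
  relabel (Equiv.Set.sumCompl s) (Equiv.Set.sumCompl u) (G₁.disjointUnion G₂)

theorem glue_eq_iff {G₁ : Multigraph s u} {G₂ : Multigraph ↥sᶜ ↥uᶜ} :
    glue G₁ G₂ = G ↔ ∃ hG : G.IsSplit s u, hG.restrict = G₁ ∧ hG.compl.restrict = G₂ := by
  classical
  rw [glue, relabel_eq_iff]
  simp only [disjointUnion_vert, disjointUnion_flip, Sum.forall, Sum.map_inl, Sum.map_inr,
    Equiv.Set.sumCompl_apply_inl, Equiv.Set.sumCompl_apply_inr]
  constructor
  · rintro ⟨⟨hv₁, hv₂⟩, hf₁, hf₂⟩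
    have h_split : G.IsSplit s u := by
      refine ⟨fun h => ?_, fun h => ?_⟩ <;> by_cases hh : h ∈ u <;>
        simp only [hh, iff_true, iff_false]
      · exact hv₁ ⟨h, hh⟩ ▸ (G₁.vert ⟨h, hh⟩).2
      · exact hv₂ ⟨h, hh⟩ ▸ (G₂.vert ⟨h, hh⟩).2
      · exact hf₁ ⟨h, hh⟩ ▸ (G₁.flip ⟨h, hh⟩).2
      · exact hf₂ ⟨h, hh⟩ ▸ (G₂.flip ⟨h, hh⟩).2
    exact ⟨h_split, Multigraph.ext (funext fun h => Subtype.ext (hv₁ h))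
      (funext fun h => Subtype.ext (hf₁ h)), Multigraph.ext (funext fun h => Subtype.ext (hv₂ h))
      (funext fun h => Subtype.ext (hf₂ h))⟩
  · rintro ⟨hG, rfl, rfl⟩
    exact ⟨⟨fun _ => rfl, fun _ => rfl⟩, fun _ => rfl, fun _ => rfl⟩

/-- The vertices that can be reached from `a`. -/
def reachable (G : Multigraph V H) (a : V) : Set V := {v | Relation.ReflTransGen G.Adj a v}

/-- `s` is the set of vertices and `u` the set of half-edges of a connected component of `G`. -/
def IsComponent (G : Multigraph V H) (s : Set V) (u : Set H) : Prop :=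
  ∃ hG : G.IsSplit s u, hG.restrict.Connected

theorem isSplit_reachable (G : Multigraph V H) (a : V) :
    G.IsSplit (G.reachable a) (G.vert ⁻¹' G.reachable a) := by
  refine ⟨fun h => Iff.rfl, fun h => ⟨fun hh => ?_, fun hh => ?_⟩⟩
  · exact Relation.ReflTransGen.tail hh ⟨G.flip h, rfl, by rw [G.flip_flip]⟩
  · exact Relation.ReflTransGen.tail hh ⟨h, rfl, rfl⟩

theorem IsSplit.adj_restrict_iff (hG : G.IsSplit s u) {a b : s} :
    hG.restrict.Adj a b ↔ G.Adj a b := by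
  constructor
  · rintro ⟨h, rfl, rfl⟩
    exact ⟨h, rfl, rfl⟩
  · rintro ⟨h, ha, hb⟩
    exact ⟨⟨h, (hG.vert_mem_iff h).1 (ha ▸ a.2)⟩, Subtype.ext ha, Subtype.ext hb⟩

theorem IsSplit.reflTransGen_restrict_iff (hG : G.IsSplit s u) {a : s} {b : V} :
    Relation.ReflTransGen G.Adj a b ↔
      ∃ hb : b ∈ s, Relation.ReflTransGen hG.restrict.Adj a ⟨b, hb⟩ := by
  refine ⟨fun hab => ?_, fun ⟨_, hab⟩ =>
    hab.lift Subtype.val fun _ _ => hG.adj_restrict_iff.1⟩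
  induction hab with
  | refl => exact ⟨a.2, .refl⟩
  | @tail b c _ hbc ih =>
    obtain ⟨hb, hab⟩ := ih
    have hc : c ∈ s := by
      obtain ⟨h, rfl, rfl⟩ := hbc
      exact (hG.vert_mem_iff _).2 ((hG.flip_mem_iff h).2 ((hG.vert_mem_iff h).1 hb))
    exact ⟨hc, hab.tail (hG.adj_restrict_iff.2 hbc)⟩

theorem isComponent_iff {h : H} (hu : h ∈ u) :
    G.IsComponent s u ↔ s = G.reachable (G.vert h) ∧ u = G.vert ⁻¹' s := by
  constructor
  · rintro ⟨hG, hG'⟩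
    have hs : G.vert h ∈ s := (hG.vert_mem_iff h).2 hu
    refine ⟨Set.ext fun v => ⟨fun hv => ?_, fun hv => ?_⟩,
      Set.ext fun h => (hG.vert_mem_iff h).symm⟩
    · exact hG.reflTransGen_restrict_iff.2 ⟨hv, hG'.2 ⟨_, hs⟩ ⟨v, hv⟩⟩
    · exact (hG.reflTransGen_restrict_iff (a := ⟨_, hs⟩).1 hv).1
  · rintro ⟨rfl, rfl⟩
    refine ⟨G.isSplit_reachable _, ⟨⟨_, .refl⟩⟩, fun a b => ?_⟩
    have h_symm : Std.Symm G.Adj := ⟨fun _ _ ⟨h, ha, hb⟩ => ⟨G.flip h, hb, by rw [G.flip_flip, ha]⟩⟩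
    have hab : Relation.ReflTransGen G.Adj a b := (symm a.2).trans b.2
    exact ((G.isSplit_reachable _).reflTransGen_restrict_iff.1 hab).2

end Multigraph

/-! ### The exponential formula -/

instance {V H : Type*} [IsEmpty V] [IsEmpty H] : Unique (Multigraph V H) where
  default := ⟨isEmptyElim, isEmptyElim, isEmptyElim, isEmptyElim⟩
  uniq _ := Multigraph.ext (Subsingleton.elim _ _) (Subsingleton.elim _ _)

open Classical in
theorem Multigraph.sum_card_component {V H : Type*} [Fintype V] [Fintype H]
    (G : Multigraph V H) :
    ∑ x : Finset V × Finset H with G.IsComponent x.1 x.2, #x.2 = Fintype.card H := by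
  have h_one (h : H) :
      #{x : Finset V × Finset H | G.IsComponent x.1 x.2 ∧ h ∈ x.2} = 1 := by
    let s : Finset V := {v | v ∈ G.reachable (G.vert h)}
    have hs : (s : Set V) = G.reachable (G.vert h) := by simp [s]
    have mem_root : G.vert h ∈ G.reachable (G.vert h) := Relation.ReflTransGen.refl
    refine card_eq_one.2 ⟨(s, univ.filter fun h' => G.vert h' ∈ s), Finset.ext fun x => ?_⟩
    simp only [mem_filter_univ, mem_singleton, Prod.ext_iff]
    constructor
    · rintro ⟨hx, hh⟩
      obtain ⟨h₁, h₂⟩ := (isComponent_iff (mem_coe.2 hh)).1 hx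
      rw [← hs, coe_inj] at h₁
      rw [h₁] at h₂
      exact ⟨h₁, Finset.ext fun h' => by simpa using Set.ext_iff.1 h₂ h'⟩
    · rintro ⟨h₁, h₂⟩
      have hh : h ∈ x.2 := by simp [h₂, s, mem_root]
      exact ⟨(isComponent_iff (mem_coe.2 hh)).2 ⟨by rw [h₁, hs], by ext; simp [h₁, h₂]⟩, hh⟩
  calc ∑ x : Finset V × Finset H with G.IsComponent x.1 x.2, #x.2
      = ∑ h : H, #{x : Finset V × Finset H | G.IsComponent x.1 x.2 ∧ h ∈ x.2} := by
        simpa [bipartiteAbove, bipartiteBelow, filter_filter] using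
          sum_card_bipartiteAbove_eq_sum_card_bipartiteBelow
            (s := {x : Finset V × Finset H | G.IsComponent x.1 x.2}) (t := univ)
            fun x h => h ∈ x.2
    _ = Fintype.card H := by simp [h_one]

section ExponentialFormula

open PowerSeries

variable {R : Type*} [CommRing R]

/-- An isomorphism invariant that is multiplicative with respect to disjoint unions. -/
structure IsMultiplicative (w : GraphClass → R) : Prop where
  map_isEmpty {V H : Type} [Finite V] [Finite H] [IsEmpty V] (G : Multigraph V H) :
    w G.toClass = 1
  map_disjointUnion {V₁ H₁ V₂ H₂ : Type} [Finite V₁] [Finite H₁] [Finite V₂] [Finite H₂]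
    (G₁ : Multigraph V₁ H₁) (G₂ : Multigraph V₂ H₂) :
    w (G₁.disjointUnion G₂).toClass = w G₁.toClass * w G₂.toClass

variable {w : GraphClass → R}

open Multigraph

theorem IsMultiplicative.map_glue (hw : IsMultiplicative w) {V H : Type} [Finite V] [Finite H]
    {s : Set V} {u : Set H} (G₁ : Multigraph s u) (G₂ : Multigraph ↥sᶜ ↥uᶜ) :
    w (glue G₁ G₂).toClass = w G₁.toClass * w G₂.toClass := by
  rw [← hw.map_disjointUnion]
  exact congrArg w (toClass_eq_iff.2 ⟨(isoRelabel _ _ _).symm⟩)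

open Classical in
theorem IsMultiplicative.sum_isComponent (hw : IsMultiplicative w) {V H : Type} [Finite V]
    [Finite H] (s : Set V) (u : Set H) :
    ∑ G : Multigraph V H with G.IsComponent s u, w G.toClass =
      labelledSum ({q | q.Connected}.indicator w) (Nat.card s) (Nat.card u) *
        labelledSum w (Nat.card ↥sᶜ) (Nat.card ↥uᶜ) := by
  rw [← sum_toClass, ← sum_toClass, sum_mul_sum, ← sum_product', univ_product_univ]
  simp only [Set.indicator_apply, Set.mem_ofPred_eq, connected_toClass, ite_mul, zero_mul]
  rw [← sum_filter]
  refine (sum_nbij (fun G => glue G.1 G.2) ?_ ?_ ?_ fun G _ => (hw.map_glue G.1 G.2).symm).symm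
  · intro G hG
    obtain ⟨h_split, h₁, -⟩ := glue_eq_iff.1 (rfl : glue G.1 G.2 = glue G.1 G.2)
    exact (mem_filter_univ _).2 ⟨h_split, by simpa [h₁] using hG⟩
  · intro G _ G' _ hGG'
    obtain ⟨h_split, h₁, h₂⟩ := glue_eq_iff.1 hGG'
    obtain ⟨_, h₁', h₂'⟩ := glue_eq_iff.1 (rfl : glue G'.1 G'.2 = glue G'.1 G'.2)
    exact Prod.ext (h₁.symm.trans h₁') (h₂.symm.trans h₂')
  · intro G hG
    obtain ⟨h_split, h_conn⟩ := (mem_filter_univ _).1 hG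
    exact ⟨(h_split.restrict, h_split.compl.restrict), by simpa using h_conn,
      glue_eq_iff.2 ⟨h_split, rfl, rfl⟩⟩

theorem IsMultiplicative.smul_labelledSum (hw : IsMultiplicative w) (v d : ℕ) :
    d • labelledSum w v d = ∑ u : Finset (Fin d), #u • ∑ s : Finset (Fin v),
      labelledSum ({q | q.Connected}.indicator w) #s #u * labelledSum w #sᶜ #uᶜ := by
  classical
  calc d • labelledSum w v d
      = ∑ G : Multigraph (Fin v) (Fin d),
          ∑ x : Finset (Fin v) × Finset (Fin d) with G.IsComponent x.1 x.2,
            #x.2 • w G.toClass := by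
        simp only [labelledSum, smul_sum, ← sum_smul, sum_card_component, Fintype.card_fin]
    _ = ∑ x : Finset (Fin v) × Finset (Fin d), #x.2 •
          ∑ G : Multigraph (Fin v) (Fin d) with G.IsComponent x.1 x.2, w G.toClass := by
        simp only [smul_sum, sum_filter, smul_ite, smul_zero]
        exact sum_comm
    _ = ∑ u : Finset (Fin d), ∑ s : Finset (Fin v), #u •
          (labelledSum ({q | q.Connected}.indicator w) #s #u * labelledSum w #sᶜ #uᶜ) := by
        rw [← univ_product_univ, sum_product_right]
        simp only [hw.sum_isComponent, ← coe_compl, Nat.card_coe_set_eq, Set.ncard_coe_finset]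
    _ = _ := by simp only [smul_sum]

theorem labelledSum_eq_zero (hw : Function.support w ⊆ ⋃ n, graphs n) {v d : ℕ} (hvd : d < v) :
    labelledSum w v d = 0 := by
  refine sum_eq_zero fun G _ => by_contra fun hG => hvd.not_ge ?_
  obtain ⟨n, hn⟩ := Set.mem_iUnion.1 (hw hG)
  simpa using (toClass_mem_graphs.1 hn).card_le

theorem sum_range_sum_antidiagonal {M : Type*} [AddCommMonoid M] {m n : ℕ} {f : ℕ × ℕ → M}
    (hf : ∀ x, m < x.1 ∨ n < x.2 → f x = 0) :
    ∑ v ∈ range (m + n + 1), ∑ x ∈ antidiagonal v, f x =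
      ∑ i ∈ range (m + 1), ∑ j ∈ range (n + 1), f (i, j) := by
  rw [← sum_product', ← sum_fiberwise_of_maps_to (t := range (m + n + 1))
    (g := fun x : ℕ × ℕ => x.1 + x.2) fun x hx => by
      simp only [mem_product, mem_range] at hx ⊢
      lia]
  refine sum_congr rfl fun v _ => (sum_subset (fun x hx => ?_) fun x hx hx' => hf x ?_).symm
  · simpa using (mem_filter.1 hx).2
  · simp only [mem_filter, mem_product, mem_range, HasAntidiagonal.mem_antidiagonal] at hx hx'
    lia

variable [Algebra ℚ R]

theorem sum_subsets_mul {m n : ℕ} {a b : ℕ → R} (ha : ∀ i, m < i → a i = 0)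
    (hb : ∀ j, n < j → b j = 0) :
    ∑ v ∈ range (m + n + 1), (v ! : ℚ)⁻¹ • ∑ s : Finset (Fin v), a #s * b #sᶜ =
      (∑ i ∈ range (m + 1), (i ! : ℚ)⁻¹ • a i) * ∑ j ∈ range (n + 1), (j ! : ℚ)⁻¹ • b j := by
  have h_subsets (v : ℕ) := sum_card_card_compl (Fin v) fun i j => a i * b j
  simp only [Fintype.card_fin] at h_subsets
  rw [sum_mul_sum]
  simp only [h_subsets, smul_mul_smul_comm]
  refine sum_range_sum_antidiagonal fun x hx => ?_
  rcases hx with hx | hx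
  · rw [ha _ hx, zero_mul, smul_zero]
  · rw [hb _ hx, mul_zero, smul_zero]

theorem constantCoeff_labelledSeries (w : GraphClass → R) :
    constantCoeff (labelledSeries w) =
      w (default : Multigraph (Fin 0) (Fin 0)).toClass := by
  rw [← coeff_zero_eq_constantCoeff_apply, labelledSeries, coeff_egf, halfEdgeLabelledSum]
  simp [labelledSum]

theorem IsMultiplicative.constantCoeff_eq_one (hw : IsMultiplicative w) :
    constantCoeff (labelledSeries w) = 1 := by
  rw [constantCoeff_labelledSeries, hw.map_isEmpty]

theorem IsMultiplicative.smul_halfEdgeLabelledSum (hw : IsMultiplicative w)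
    (hw' : Function.support w ⊆ ⋃ n, graphs n) (d : ℕ) :
    d • halfEdgeLabelledSum w d = ∑ u : Finset (Fin d),
      (#u • halfEdgeLabelledSum ({q | q.Connected}.indicator w) #u) *
        halfEdgeLabelledSum w #uᶜ := by
  rw [halfEdgeLabelledSum, smul_sum]
  simp only [smul_comm d, hw.smul_labelledSum]
  simp only [smul_sum (s := univ (α := Finset (Fin d)))]
  rw [sum_comm]
  refine sum_congr rfl fun u _ => ?_
  have hd : d = #u + #uᶜ := by rw [card_add_card_compl, Fintype.card_fin]
  rw [smul_mul_assoc, halfEdgeLabelledSum, halfEdgeLabelledSum, ← sum_subsets_mul, smul_sum, ← hd]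
  · exact sum_congr rfl fun v _ => smul_comm _ _ _
  · exact fun v => labelledSum_eq_zero
      (Set.support_indicator.trans_subset (Set.inter_subset_right.trans hw'))
  · exact fun v => labelledSum_eq_zero hw'

theorem IsMultiplicative.derivative_labelledSeries (hw : IsMultiplicative w)
    (hw' : Function.support w ⊆ ⋃ n, graphs n) :
    derivative R (labelledSeries w) =
      derivative R (labelledSeries ({q | q.Connected}.indicator w)) * labelledSeries w := by
  refine X_mul_cancel ?_
  rw [← mul_assoc, labelledSeries, labelledSeries, X_mul_derivative_egf, X_mul_derivative_egf,
    egf_mul_egf]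
  exact congrArg egf (funext (hw.smul_halfEdgeLabelledSum hw'))

theorem IsMultiplicative.labelledSeries_connected (hw : IsMultiplicative w)
    (hw' : Function.support w ⊆ ⋃ n, graphs n) :
    labelledSeries ({q | q.Connected}.indicator w) = logOf (labelledSeries w) := by
  refine eq_logOf_of_derivative hw.constantCoeff_eq_one ?_
    (hw.derivative_labelledSeries hw')
  rw [constantCoeff_labelledSeries, Set.indicator_of_notMem]
  exact fun h => IsEmpty.false (connected_toClass.1 h).1.some

end ExponentialFormula

/-- The contribution to the black-white polynomial of a vertex of color `c` with `n` black
neighbours. -/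
def colorWeight (c : ZMod 2) (n : ℕ) : Coeff := if c = 0 ∧ Even n then t else 1

namespace Multigraph

variable {V H V₁ H₁ V₂ H₂ : Type*} [Fintype V] [DecidableEq V] [Fintype H]

theorem bwWeight_toClass_eq_sum (G : Multigraph V H) :
    bwWeight G.toClass =
      ∑ c : V → ZMod 2, ∏ v, colorWeight (c v) (G.blackDegree c v) * degVar (G.degree v) := by
  simp only [bwWeight_toClass, bwPoly, map_sum, map_pow, Polynomial.aeval_X, prod_mul_distrib,
    sum_mul, colorWeight, prod_ite, prod_const, one_pow, mul_one]

variable [DecidableEq V₁] [Fintype H₁] [DecidableEq V₂] [Fintype H₂]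
  (G₁ : Multigraph V₁ H₁) (G₂ : Multigraph V₂ H₂)

theorem degree_disjointUnion_inl (v : V₁) :
    (G₁.disjointUnion G₂).degree (.inl v) = G₁.degree v := by
  simp [degree, card_filter, -sum_boole]

theorem degree_disjointUnion_inr (v : V₂) :
    (G₁.disjointUnion G₂).degree (.inr v) = G₂.degree v := by
  simp [degree, card_filter, -sum_boole]

theorem blackDegree_disjointUnion_inl (c : V₁ ⊕ V₂ → ZMod 2) (v : V₁) :
    (G₁.disjointUnion G₂).blackDegree c (.inl v) = G₁.blackDegree (c ∘ .inl) v := by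
  simp [blackDegree, card_filter, -sum_boole]

theorem blackDegree_disjointUnion_inr (c : V₁ ⊕ V₂ → ZMod 2) (v : V₂) :
    (G₁.disjointUnion G₂).blackDegree c (.inr v) = G₂.blackDegree (c ∘ .inr) v := by
  simp [blackDegree, card_filter, -sum_boole]

end Multigraph

open Multigraph

theorem isMultiplicative_bwWeight : IsMultiplicative bwWeight where
  map_isEmpty {V H} _ _ _ G := by
    classical
    cases nonempty_fintype V
    cases nonempty_fintype H
    simp [bwWeight_toClass_eq_sum]
  map_disjointUnion {V₁ H₁ V₂ H₂} _ _ _ _ G₁ G₂ := by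
    classical
    cases nonempty_fintype V₁
    cases nonempty_fintype V₂
    cases nonempty_fintype H₁
    cases nonempty_fintype H₂
    rw [bwWeight_toClass_eq_sum, bwWeight_toClass_eq_sum, bwWeight_toClass_eq_sum, sum_mul_sum,
      ← Fintype.sum_prod_type', ← (Equiv.sumArrowEquivProdArrow V₁ V₂ (ZMod 2)).sum_comp]
    simp only [Fintype.prod_sum_type, degree_disjointUnion_inl, degree_disjointUnion_inr,
      blackDegree_disjointUnion_inl, blackDegree_disjointUnion_inr]
    rfl

/-! ### Wick's theorem -/

section Wick

/-- The variable with which a pairing variable is contracted: the only nonzero quadratic moments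
are `⟨b²⟩ = ⟨w²⟩ = ⟨yz⟩ = 1`. -/
def PVar.partner : PVar → PVar
  | .b => .b
  | .w => .w
  | .y => .z
  | .z => .y

theorem PVar.partner_partner (a : PVar) : a.partner.partner = a := by cases a <;> rfl

theorem wick_succ (n : ℕ) : wick (n + 1) = n * wick (n - 1) := by
  rcases n with _ | n
  · simp [wick]
  rw [Nat.add_sub_cancel]
  have h_parity : Even (n + 1 + 1) ↔ Even n := by grind
  by_cases h : Even n
  · rw [wick, wick, if_pos (h_parity.2 h), if_pos h]
    obtain ⟨k, rfl⟩ := h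
    rw [show (k + k + 1 + 1) / 2 = k + 1 by lia, show (k + k) / 2 = k by lia, Nat.factorial_succ,
      Nat.factorial_succ (k + k), Nat.factorial_succ k]
    push_cast
    field_simp
    ring
  · rw [wick, wick, if_neg (h_parity.not.2 h), if_neg h, mul_zero]

theorem ite_succ_eq_factorial (i j : ℕ) :
    (if i + 1 = j then ((i + 1)! : ℚ) else 0) = j * if i = j - 1 then (i ! : ℚ) else 0 := by
  rcases j with _ | j
  · simp
  · by_cases h : i = j
    · simp [h, Nat.factorial_succ]
    · simp [h]

theorem ite_eq_succ_factorial (i j : ℕ) :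
    (if i = j + 1 then (i ! : ℚ) else 0) = i * if i - 1 = j then ((i - 1)! : ℚ) else 0 := by
  rcases i with _ | i
  · simp
  · by_cases h : i = j
    · simp [h, Nat.factorial_succ]
    · simp [h]

theorem moment_single_add (a : PVar) (m : PVar →₀ ℕ) :
    moment (Finsupp.single a 1 + m) =
      m a.partner * moment (m - Finsupp.single a.partner 1) := by
  simp only [moment, Finsupp.add_apply, Finsupp.tsub_apply, Finsupp.single_apply]
  cases a <;> simp only [PVar.partner, reduceCtorEq, if_true, if_false, zero_add, tsub_zero,
    add_comm 1, wick_succ, ite_succ_eq_factorial, ite_eq_succ_factorial] <;> ring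

theorem leibniz_prod {R A M ι : Type*} [CommSemiring R] [CommSemiring A] [AddCommMonoid M]
    [Algebra R A] [Module A M] [Module R M] [DecidableEq ι] (D : Derivation R A M) (s : Finset ι)
    (f : ι → A) : D (∏ i ∈ s, f i) = ∑ i ∈ s, (∏ j ∈ s.erase i, f j) • D (f i) := by
  induction s using Finset.induction_on with
  | empty => simp
  | insert a s ha ih =>
    rw [prod_insert ha, D.leibniz, ih, sum_insert ha, erase_insert ha, add_comm, smul_sum]
    congr 1
    refine sum_congr rfl fun i hi => ?_
    have hia : a ≠ i := fun h => ha (h ▸ hi)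
    rw [smul_smul, erase_insert_of_ne hia, prod_insert fun h => ha (mem_of_mem_erase h)]

variable {R : Type*} [CommRing R] [Algebra ℚ R]

theorem expect_X_mul (a : PVar) (P : MvPolynomial PVar R) :
    expect R (MvPolynomial.X a * P) = expect R (MvPolynomial.pderiv a.partner P) := by
  suffices h : expect R ∘ₗ LinearMap.mulLeft R (MvPolynomial.X a) =
      expect R ∘ₗ (MvPolynomial.pderiv a.partner).toLinearMap from LinearMap.congr_fun h P
  refine MvPolynomial.linearMap_ext fun m => LinearMap.ext_ring ?_
  simp [MvPolynomial.X, MvPolynomial.monomial_mul, MvPolynomial.pderiv_monomial, expect_monomial,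
    moment_single_add]

variable {H : Type*} {l : H → PVar} {h₀ h₁ : H}

/-- The fixed-point free involutions that are compatible with a labelling by pairing variables:
the pairings of the factors of `∏ h, X (l h)` in Wick's theorem. -/
abbrev Contraction (l : H → PVar) : Type _ :=
  {f : H → H // f.Involutive ∧ (∀ h, f h ≠ h) ∧ ∀ h, l (f h) = (l h).partner}

/-- Removal of a contracted pair. -/
@[simps] def Contraction.erasePair (f : {f : Contraction l // f.1 h₀ = h₁}) :
    Contraction fun x : {x // x ≠ h₀ ∧ x ≠ h₁} => l x :=
  ⟨fun x => ⟨f.1.1 x, fun h => x.2.2 ((f.1.2.1.eq_iff.1 h).trans f.2),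
      fun h => x.2.1 (f.1.2.1.injective (h.trans f.2.symm))⟩,
    fun x => Subtype.ext (f.1.2.1 x), fun x h => f.1.2.2.1 x (congrArg Subtype.val h),
    fun x => f.1.2.2.2 x⟩

theorem forall_iff_forall_ne_and_ne (h₀ h₁ : H) {P : H → Prop} :
    (∀ h, P h) ↔ P h₀ ∧ P h₁ ∧ ∀ x : {x // x ≠ h₀ ∧ x ≠ h₁}, P x := by
  refine ⟨fun h => ⟨h _, h _, fun x => h x⟩, fun ⟨hh₀, hh₁, hx⟩ h => ?_⟩
  by_cases hh : h ≠ h₀ ∧ h ≠ h₁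
  · exact hx ⟨h, hh⟩
  · rcases not_and_or.1 hh with hh | hh <;> rwa [not_not.1 hh]

theorem Contraction.erasePair_injective :
    Function.Injective (erasePair : {f : Contraction l // f.1 h₀ = h₁} → _) := by
  rintro ⟨f, rfl⟩ ⟨f', hf'⟩ h
  refine Subtype.ext (Subtype.ext (funext ((forall_iff_forall_ne_and_ne h₀ (f.1 h₀)).2
    ⟨hf'.symm, ?_, fun x => ?_⟩)))
  · exact (f.2.1 h₀).trans (f'.2.1.eq_iff.1 hf')
  · exact congrArg Subtype.val (congrFun (congrArg Subtype.val h) x)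

theorem Contraction.erasePair_surjective (hne : h₁ ≠ h₀) (hl : l h₁ = (l h₀).partner) :
    Function.Surjective (erasePair : {f : Contraction l // f.1 h₀ = h₁} → _) := by
  classical
  intro g
  let f : H → H := Function.extend Subtype.val (Subtype.val ∘ g.1) (Equiv.swap h₀ h₁)
  have hf (x : {x // x ≠ h₀ ∧ x ≠ h₁}) : f x = g.1 x := Subtype.val_injective.extend_apply _ _ x
  have hf₀ : f h₀ = h₁ :=
    (Function.extend_apply' _ _ _ (by simp)).trans (Equiv.swap_apply_left _ _)
  have hf₁ : f h₁ = h₀ :=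
    (Function.extend_apply' _ _ _ (by simp)).trans (Equiv.swap_apply_right _ _)
  have hforall {P : H → Prop} := forall_iff_forall_ne_and_ne h₀ h₁ (P := P)
  refine ⟨⟨⟨f, hforall.2 ⟨?_, ?_, fun x => ?_⟩, hforall.2 ⟨?_, ?_, fun x => ?_⟩,
    hforall.2 ⟨?_, ?_, fun x => ?_⟩⟩, hf₀⟩, ?_⟩
  · rw [hf₀, hf₁]
  · rw [hf₁, hf₀]
  · rw [hf, hf, g.2.1]
  · rwa [hf₀]
  · rwa [hf₁, ne_comm]
  · rw [hf]
    exact fun h => g.2.2.1 x (Subtype.ext h)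
  · rw [hf₀, hl]
  · rw [hf₁, hl, PVar.partner_partner]
  · rw [hf]
    exact g.2.2.2 x
  · exact Subtype.ext (funext fun x => Subtype.ext (hf x))

theorem card_contraction_eq_sum [Fintype H] [DecidableEq H] (l : H → PVar) (h₀ : H) :
    Nat.card (Contraction l) = ∑ h₁ ∈ univ.erase h₀ with l h₁ = (l h₀).partner,
      Nat.card (Contraction fun x : {x // x ≠ h₀ ∧ x ≠ h₁} => l x) := by
  rw [← Nat.card_congr (Equiv.sigmaFiberEquiv fun f : Contraction l => f.1 h₀), Nat.card_sigma]
  refine (sum_subset_zero_on_sdiff (subset_univ _) (fun h₁ hh₁ => ?_) fun h₁ hh₁ => ?_).symm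
  · refine Nat.card_eq_zero.2 (.inl ⟨?_⟩)
    rintro ⟨f, rfl⟩
    simp [f.2.2.1 h₀, f.2.2.2 h₀] at hh₁
  · obtain ⟨hne, hl⟩ := mem_filter.1 hh₁
    exact (Nat.card_congr (Equiv.ofBijective _ ⟨Contraction.erasePair_injective,
      Contraction.erasePair_surjective (ne_of_mem_erase hne) hl⟩)).symm

theorem expect_one : expect R 1 = 1 := by
  rw [← MvPolynomial.C_1, ← MvPolynomial.monomial_zero', expect_monomial]
  simp [moment, wick]

theorem card_contraction_of_isEmpty [IsEmpty H] (l : H → PVar) : Nat.card (Contraction l) = 1 :=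
  haveI : Nonempty (Contraction l) := ⟨⟨id, isEmptyElim, isEmptyElim, isEmptyElim⟩⟩
  haveI : Subsingleton (Contraction l) := inferInstance
  Nat.card_eq_one_iff_unique.2 ⟨inferInstance, inferInstance⟩

theorem expect_prod_X [Fintype H] (l : H → PVar) :
    expect R (∏ h, MvPolynomial.X (l h)) = (Nat.card (Contraction l) : R) := by
  classical
  induction hn : Fintype.card H using Nat.strong_induction_on generalizing H with | _ n ih
  subst hn
  rcases isEmpty_or_nonempty H with hH | ⟨⟨h₀⟩⟩
  · rw [univ_eq_empty, prod_empty, expect_one, card_contraction_of_isEmpty, Nat.cast_one]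
  rw [← mul_prod_erase _ _ (mem_univ h₀), expect_X_mul, leibniz_prod, map_sum,
    card_contraction_eq_sum l h₀, sum_filter, Nat.cast_sum]
  refine sum_congr rfl fun h₁ _ => ?_
  have h_erase : ∏ h ∈ (univ.erase h₀).erase h₁, MvPolynomial.X (l h) =
      ∏ x : {x // x ≠ h₀ ∧ x ≠ h₁}, (MvPolynomial.X (l x) : MvPolynomial PVar R) :=
    prod_subtype _ (by simp [and_comm]) _
  rw [MvPolynomial.pderiv_X, Pi.single_apply]
  split_ifs with hl
  · rw [smul_eq_mul, mul_one, h_erase]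
    exact ih _ (Fintype.card_subtype_lt (x := h₀) (by simp)) _ rfl
  · rw [smul_zero, map_zero, Nat.cast_zero]

end Wick

/-! ### Flowers -/

section Flowers

open MvPolynomial

/-- The pairing variable of a half-edge at a vertex of color `a` whose other end has color `e`. -/
def label (a e : ZMod 2) : PVar :=
  if a = 1 then (if e = 1 then .b else .y) else (if e = 1 then .z else .w)

theorem partner_label : ∀ a e : ZMod 2, (label a e).partner = label e a := by
  decide

theorem label_eq_label_iff : ∀ {a e a' e' : ZMod 2}, label a e = label a' e' ↔ a = a' ∧ e = e' := by
  decide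

theorem eq_zero_of_ne_one : ∀ {a : ZMod 2}, a ≠ 1 → a = 0 := by
  decide

theorem sum_zmod_two_card_eq_one {M H : Type*} [AddCommMonoid M] [Fintype H] [DecidableEq H]
    (g : ℕ → M) :
    ∑ ε : H → ZMod 2, g #{h | ε h = 1} =
      ∑ i ∈ range (Fintype.card H + 1), (Fintype.card H).choose i • g i := by
  rw [← card_univ, ← sum_powerset_apply_card, powerset_univ]
  refine sum_nbij' (fun ε : H → ZMod 2 => ({h | ε h = 1} : Finset H))
    (fun s h => if h ∈ s then 1 else 0) (by simp) (by simp) (fun ε _ => funext fun h => ?_)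
    (fun s _ => by ext h; simp) fun _ _ => rfl
  simp only [mem_filter_univ]
  split_ifs with hε
  · exact hε.symm
  · exact (eq_zero_of_ne_one hε).symm

theorem flower_eq_sum (n : ℕ) :
    flower n = ∑ a : ZMod 2, ∑ i ∈ range (n + 1), n.choose i •
      (C (colorWeight a i) * (X (label a 1) ^ i * X (label a 0) ^ (n - i))) := by
  have h_sum (F : ZMod 2 → MvPolynomial PVar Coeff) : ∑ a, F a = F 1 + F 0 :=
    (Fin.sum_univ_two F).trans (add_comm _ _)
  rw [h_sum, flower, add_pow]
  congr 1 <;> refine sum_congr rfl fun i _ => ?_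
  · simp [colorWeight, label, mul_comm]
  · rw [colorWeight, label, label, p]
    simp only [zero_ne_one, if_false, if_true, true_and, nsmul_eq_mul]
    ring

theorem prod_X_label {H : Type*} [Fintype H] (a : ZMod 2) (ε : H → ZMod 2) :
    ∏ h, (X (label a (ε h)) : MvPolynomial PVar Coeff) =
      X (label a 1) ^ #{h | ε h = 1} * X (label a 0) ^ (Fintype.card H - #{h | ε h = 1}) := by
  classical
  rw [← prod_filter_mul_prod_filter_not univ (ε · = 1), ← card_compl,
    compl_filter]
  exact congrArg₂ _ (prod_eq_pow_card fun h hh => by rw [(mem_filter.1 hh).2])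
    (prod_eq_pow_card fun h hh => by rw [eq_zero_of_ne_one (mem_filter.1 hh).2])

theorem flower_card (H : Type*) [Fintype H] [DecidableEq H] :
    flower (Fintype.card H) = ∑ a : ZMod 2, ∑ ε : H → ZMod 2,
      C (colorWeight a #{h | ε h = 1}) * ∏ h, X (label a (ε h)) := by
  simp only [prod_X_label]
  rw [flower_eq_sum]
  exact sum_congr rfl fun a _ => (sum_zmod_two_card_eq_one (H := H) _).symm

variable {V H : Type*} [Fintype V] [DecidableEq V] [Fintype H]

theorem prod_flower [DecidableEq H] (f : H → V) :
    ∏ v, flower #{h | f h = v} = ∑ c : V → ZMod 2, ∑ ε : H → ZMod 2,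
      C (∏ v, colorWeight (c v) #{h | f h = v ∧ ε h = 1}) * ∏ h, X (label (c (f h)) (ε h)) := by
  let e : (H → ZMod 2) ≃ ((v : V) → {h // f h = v} → ZMod 2) :=
    ((Equiv.sigmaFiberEquiv f).arrowCongr (Equiv.refl _)).symm.trans
      (Equiv.piCurry fun _ _ => ZMod 2)
  simp only [← Fintype.card_subtype, flower_card]
  rw [Fintype.prod_sum]
  refine sum_congr rfl fun c _ => ?_
  rw [Fintype.prod_sum, ← e.sum_comp]
  refine sum_congr rfl fun ε _ => ?_
  have he (v) (h : {h // f h = v}) : e ε v h = ε h := rfl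
  simp only [he]
  rw [prod_mul_distrib, map_prod]
  congr 1
  · refine prod_congr rfl fun v _ => congrArg (C ∘ colorWeight (c v)) ?_
    exact Fintype.card_congr
      (Equiv.subtypeSubtypeEquivSubtypeInter (fun h => f h = v) fun h => ε h = 1)
  · rw [← Fintype.prod_fiberwise f]
    exact prod_congr rfl fun v _ => prod_congr rfl fun h _ => by rw [h.2]

/-- The contractions of a product of flowers, with the half-edges colored at both ends, are the
multigraphs that induce these colors. -/
def contractionEquivMultigraph {V H : Type*} (f : H → V) (c : V → ZMod 2) (ε : H → ZMod 2) :
    Contraction (fun h => label (c (f h)) (ε h)) ≃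
      {G : Multigraph V H // G.vert = f ∧ (fun h => c (G.vert (G.flip h))) = ε} where
  toFun g := ⟨⟨f, g.1, g.2.1, g.2.2.1⟩, rfl, funext fun h =>
    (label_eq_label_iff.1 ((g.2.2.2 h).trans (partner_label _ _))).1⟩
  invFun G := ⟨G.1.flip, G.1.flip_flip, G.1.flip_ne, fun h => by
    obtain ⟨G, rfl, rfl⟩ := G
    simp only [partner_label, G.flip_flip]⟩
  right_inv := by
    rintro ⟨G, rfl, rfl⟩
    rfl

theorem expect_prod_flower (f : H → V) :
    expect Coeff (∏ v, flower #{h | f h = v}) =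
      ∑ G : Multigraph V H with G.vert = f,
        ∑ c : V → ZMod 2, ∏ v, colorWeight (c v) (G.blackDegree c v) := by
  classical
  rw [prod_flower, sum_comm (s := {G : Multigraph V H | G.vert = f}), map_sum]
  refine sum_congr rfl fun c _ => ?_
  rw [← sum_fiberwise _ fun (G : Multigraph V H) h => c (G.vert (G.flip h)), map_sum]
  refine sum_congr rfl fun ε _ => ?_
  rw [← smul_eq_C_mul, map_smul, expect_prod_X, Nat.card_congr (contractionEquivMultigraph f c ε),
    Nat.card_eq_fintype_card, Fintype.card_subtype, filter_filter, smul_eq_mul, mul_comm,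
    ← nsmul_eq_mul, ← sum_const]
  refine sum_congr rfl fun G hG => ?_
  obtain ⟨rfl, rfl⟩ := (mem_filter.1 hG).2
  rfl

theorem sum_expect_prod_flower (V H : Type*) [Fintype V] [DecidableEq V] [Fintype H]
    [DecidableEq H] :
    ∑ f : H → V, expect Coeff (∏ v, flower #{h | f h = v} * C (degVar #{h | f h = v})) =
      ∑ G : Multigraph V H, bwWeight G.toClass := by
  rw [← sum_fiberwise _ Multigraph.vert]
  refine sum_congr rfl fun f _ => ?_
  rw [prod_mul_distrib, ← map_prod, mul_comm, ← smul_eq_C_mul, map_smul, expect_prod_flower,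
    smul_eq_mul, mul_sum]
  refine sum_congr rfl fun G hG => ?_
  obtain rfl := (mem_filter.1 hG).2
  rw [Multigraph.bwWeight_toClass_eq_sum, mul_comm, sum_mul]
  exact sum_congr rfl fun c _ => prod_mul_distrib.symm

theorem S_eq_egf : S = egf fun k => flower k * C (degVar k) := by
  ext1 k
  rw [S, PowerSeries.coeff_mk]
  refine Eq.trans ?_ (coeff_egf _ _).symm
  split_ifs with hk
  · rw [degVar, dif_pos hk]
  · rw [Nat.eq_zero_of_not_pos hk, degVar_zero, map_zero, mul_zero, smul_zero]

theorem expect_rat_smul (r : ℚ) (P : MvPolynomial PVar Coeff) :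
    expect Coeff (r • P) = r • expect Coeff P := by
  rw [← algebraMap_smul Coeff r P, map_smul, algebraMap_smul]

theorem expectSeries_expS : expectSeries expS = labelledSeries bwWeight := by
  ext1 d
  rw [expectSeries, PowerSeries.coeff_mk, expS, S_eq_egf, coeff_exp_subst_egf]
  · rw [map_sum, labelledSeries, coeff_egf, halfEdgeLabelledSum, smul_sum]
    refine sum_congr rfl fun v _ => ?_
    rw [expect_rat_smul, map_sum, sum_expect_prod_flower, sum_toClass, Nat.card_fin, Nat.card_fin,
      smul_smul, mul_comm]
  · rw [degVar_zero, map_zero, mul_zero]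

end Flowers

end BW

end

theorem theorem3p2 :
    -- the sums over graphs that define the coefficients of the two graph series are finite
    (∀ d : ℕ, {n : ℕ+ →₀ ℕ | BW.profileSize n = d}.Finite) ∧
    (∀ n : ℕ+ →₀ ℕ, (BW.graphs n).Finite) ∧
    -- the expectation is the series of all graphs
    BW.expectSeries BW.expS = BW.graphSeries BW.graphs ∧
    -- the series of the connected graphs is its logarithm (of a series with constant term `1`)
    PowerSeries.constantCoeff (BW.expectSeries BW.expS) = 1 ∧
    BW.connectedSeries = PowerSeries.logOf (BW.expectSeries BW.expS) := by
  have h_log := BW.isMultiplicative_bwWeight.labelledSeries_connected BW.support_bwWeight_subset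
  refine ⟨BW.finite_profileSize_eq, BW.finite_graphs, ?_, ?_, ?_⟩
  · rw [BW.expectSeries_expS, BW.graphSeries_graphs]
  · rw [BW.expectSeries_expS, BW.isMultiplicative_bwWeight.constantCoeff_eq_one]
  · rw [BW.expectSeries_expS, BW.connectedSeries_eq, h_log]
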